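/- **Setting.** A finite road network consists of links and intersections. Each link $k$ is an interval $[a_k,b_k]$, $a_k<b_k$, with jam density $\rho_{j,k}>0$ and a fundamental diagram $f_k$ on $[0,\rho_{j,k}]$ that is continuous, concave and vanishes at $0$ and at $\rho_{j,k}$; $C_k=\max f_k$ is its capacity. A density $r$ is *uncongested* if $f_k$ is nondecreasing on $[0,r]$, and *congested* otherwise. Each link starts at an intersection or enters the network from outside, and ends at an intersection or leaves the network. A fixed fraction $\alpha_{jk}\ge 0$ of the traffic leaving $j$ turns into $k$, where $\alpha_{jk}\neq 0$ only if $k$ starts at the intersection at which $j$ ends, and $\sum_k\alpha_{jk}=1$ if $j$ ends at an intersection (at a merge, with a single outgoing link $k$, $\alpha_{jk}=1$). Splits $\eta_j>0$ are given, summing to $1$ over the links ending at each intersection (so $\eta_1$ and $1-\eta_1$ for two incoming links); $\eta_j=1$ for links leaving the network. Measurable initial densities $\rho_{0,k}$ with values in $[0,\rho_{j,k}]$ and, for entering links, measurable arrival rates $d_k\ge 0$ are given. **Solutions.** Let $T>0$ and let $g_j(t)$ be a control for each link $j$. A solution on $[0,T]$ is a family of Moskowitz functions $N_k(t,x)$ on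 $[0,T]\times[a_k,b_k]$ with the following properties. 1. $N_k$ is the viability episolution of $\partial_tN_k-f_k(-\partial_xN_k)=0$ associated with its own values on $\{0\}\times[a_k,b_k]$, $[0,T]\times\{a_k\}$ and $[0,T]\times\{b_k\}$. That is, $N_k(t,x)$ is the infimum of $N_k\big(t-\tau,\,x-\int_0^\tau u\big)+\int_0^\tau f_k^*(u(s))\,ds$ over all $\tau\ge0$ and integrable $u:[0,\tau]\to\mathbb R$ for which $\big(t-s,\,x-\int_0^su\big)$ stays in $[0,T]\times[a_k,b_k]$ for $s\in[0,\tau]$ and lies in one of these three sets at $s=\tau$, where $f_k^*(u)=\sup_{r\in[0,\rho_{j,k}]}(f_k(r)-ur)$. 2. $N_k(0,x)=-\int_{a_k}^x\rho_{0,k}(\xi)\,d\xi$. 3. For almost every $t\in[0,T]$ the densities $\rho_k=-\partial_xN_k$ at $a_k+$ and at $b_k-$ (one-sided derivatives) exist and lie in $[0,\rho_{j,k}]$. The demand $D_k(t)$ is $f_k(\rho_k(t,b_k-))$ if this density is uncongested and $C_k$ if it is congested; the supply $S_k(t)$ is $C_k$ if $\rho_k(t,a_k+)$ is uncongested and $f_k(\rho_k(t,a_k+))$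 if it is congested. 4. The exit flow of link $j$ is $q_j(t)=\min\{D_j(t),\,\mathcal S_j(t)\,g_j(t)\}$, where the effective supply $\mathcal S_j(t)$ is the least of $C_j$ and the numbers $S_k(t)/\alpha_{jk}$ over $k$ with $\alpha_{jk}>0$ (so $\min\{C_j,S_k(t)\}$ at a merge into $k$). The entrance flow of $k$ is $\sum_j\alpha_{jk}q_j(t)$ if $k$ starts at an intersection, and $\min\{d_k(t),S_k(t)\}$ if $k$ enters the network. These flows are integrable on $[0,T]$, and $N_k(t,b_k)-N_k(0,b_k)$ and $N_k(t,a_k)-N_k(0,a_k)$ are the integrals over $[0,t]$ of the exit and of the entrance flow of $k$, for all $t\in[0,T]$. The *continuum model* has $g_j\equiv\eta_j$. The *on-and-off model* with cycle lengths $\Delta_v>0$ at the intersections $v$ has $g_j=u_j$, where, for $j$ ending at $v$, $u_j\in\{0,1\}$ is $\Delta_v$-periodic with one green phase ($u_j=1$), of length $\eta_j\Delta_v$, in each cycle; at every time exactly one of the links ending at $v$ is green; and $u_j\equiv1$ for links leaving the network. A solution has *no spillback* if $\rho_k(t,a_k+)$ is uncongested for every link $k$ and almost every $t\in[0,T]$.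 **Corollary 4.1.** Let $N^0$ be a solution of the continuum model without spillback. Then the solutions of the on-and-off model without spillback converge to $N^0$, uniformly on every link, as all signal cycles tend to zero: for every $\varepsilon>0$ there is $\delta>0$ such that, whenever $0<\Delta_v<\delta$ for all intersections $v$, every solution $N$ without spillback of an on-and-off model with these cycle lengths (and the same splits, initial densities and arrival rates) satisfies $|N_k(t,x)-N^0_k(t,x)|<\varepsilon$ for all links $k$ and all $(t,x)\in[0,T]\times[a_k,b_k]$. -/

import Mathlib

open MeasureTheory Set

noncomputable section

/-- A road link `[a, b]` with jam density `jam` and fundamental diagram `f` on `[0, jam]`: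
continuous, concave, and vanishing at density `0` and at jam density. -/
structure RoadLink where
  a : ℝ
  b : ℝ
  a_lt_b : a < b
  jam : ℝ
  jam_pos : 0 < jam
  f : ℝ → ℝ
  continuousOn_f : ContinuousOn f (Icc 0 jam)
  concaveOn_f : ConcaveOn ℝ (Icc 0 jam) f
  f_zero : f 0 = 0
  f_jam : f jam = 0

namespace RoadLink

variable (L : RoadLink)

/-- Flow capacity: the maximum of the fundamental diagram. -/
def capacity : ℝ := sSup (L.f '' Icc 0 L.jam)

/-- A density is in the uncongested phase when it lies on the branch of the fundamental diagram
on which flow is nondecreasing in density; otherwise it is in the congested phase. -/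
def Uncongested (r : ℝ) : Prop := MonotoneOn L.f (Icc 0 r)

open scoped Classical in
/-- Demand at the exit, as a function of the density there: the capacity in the congested phase,
the flow in the uncongested phase. -/
def demand (r : ℝ) : ℝ := if L.Uncongested r then L.f r else L.capacity

open scoped Classical in
/-- Supply at the entrance, as a function of the density there: the capacity in the uncongested
phase, the flow in the congested phase. -/
def supply (r : ℝ) : ℝ := if L.Uncongested r then L.capacity else L.f r

/-- The concave transform `f*(u) = sup_{0 ≤ r ≤ jam} (f r - u r)`. It is finite for every real
`u`, because `f` is continuous on a compact interval. -/
def fStar (u : ℝ) : ℝ := sSup ((fun r => L.f r - u * r) '' Icc 0 L.jam)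

/-- The set `{0} × [a, b] ∪ [0, T] × {a} ∪ [0, T] × {b}` that carries the initial value and the
upstream and downstream boundary values. -/
def valueDomain (T : ℝ) : Set (ℝ × ℝ) :=
  {p | p.1 ∈ Icc 0 T ∧ p.2 ∈ Icc L.a L.b ∧ (p.1 = 0 ∨ p.2 = L.a ∨ p.2 = L.b)}

/-- The costs of all the evolutions that start at `(t, x)`, follow the backward dynamics
`t' = -1, x' = -u` with an integrable control `u`, remain in `[0, T] × [a, b]`, and after a time
`τ` are captured by the domain of the value condition `c`; the cost is the value of `c` where
the evolution is captured plus the integral of `f*(u)` along it. -/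
def captureCosts (T : ℝ) (c : ℝ → ℝ → ℝ) (t x : ℝ) : Set ℝ :=
  {y | ∃ (τ : ℝ) (u : ℝ → ℝ), 0 ≤ τ ∧ IntervalIntegrable u volume 0 τ ∧
    (∀ s ∈ Icc 0 τ, t - s ∈ Icc 0 T ∧ x - ∫ σ in (0 : ℝ)..s, u σ ∈ Icc L.a L.b) ∧
    (t - τ, x - ∫ σ in (0 : ℝ)..τ, u σ) ∈ L.valueDomain T ∧
    y = c (t - τ) (x - ∫ σ in (0 : ℝ)..τ, u σ) + ∫ σ in (0 : ℝ)..τ, L.fStar (u σ)}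

/-- `N` is the viability episolution of `∂ₜ N - f (-∂ₓ N) = 0` on `[0, T] × [a, b]` associated
with the value condition `c` on the initial line and on the two boundaries: the epigraph of `N`
is (up to closure) the set of the points from which the epigraph of `c` can be captured. -/
def IsEpisolution (T : ℝ) (c N : ℝ → ℝ → ℝ) : Prop :=
  ∀ t ∈ Icc 0 T, ∀ x ∈ Icc L.a L.b, IsGLB (L.captureCosts T c t x) (N t x)

/-- `N` solves the Hamilton-Jacobi equation on the link: it is the episolution associated with
its own initial and boundary values (which are thus attained). -/
def SolvesHJ (T : ℝ) (N : ℝ → ℝ → ℝ) : Prop := L.IsEpisolution T N N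

/-- The density `ρ(t, a+) = -∂ₓ N(t, a+)` at the entrance. -/
def entranceDensity (N : ℝ → ℝ → ℝ) (t : ℝ) : ℝ := -derivWithin (N t) (Ici L.a) L.a

/-- The density `ρ(t, b-) = -∂ₓ N(t, b-)` at the exit. -/
def exitDensity (N : ℝ → ℝ → ℝ) (t : ℝ) : ℝ := -derivWithin (N t) (Iic L.b) L.b

/-- The density at the entrance exists at time `t` and lies in `[0, jam]`. -/
def HasEntranceDensity (N : ℝ → ℝ → ℝ) (t : ℝ) : Prop :=
  DifferentiableWithinAt ℝ (N t) (Ici L.a) L.a ∧ L.entranceDensity N t ∈ Icc 0 L.jam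

/-- The density at the exit exists at time `t` and lies in `[0, jam]`. -/
def HasExitDensity (N : ℝ → ℝ → ℝ) (t : ℝ) : Prop :=
  DifferentiableWithinAt ℝ (N t) (Iic L.b) L.b ∧ L.exitDensity N t ∈ Icc 0 L.jam

end RoadLink

/-- A finite network of links with a fixed-cycle-and-split signal at every intersection. -/
structure SignalNetwork (Road Node : Type*) [Fintype Road] [DecidableEq Node] where
  link : Road → RoadLink
  /-- The intersection from which a link starts; `none` for a link that enters the network. -/
  source : Road → Option Node
  /-- The intersection at which a link ends; `none` for a link that leaves the network. -/
  target : Road → Option Node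
  /-- `turn j k` is the fraction of the exit flow of `j` that continues on `k`. At a merge, which
  has one outgoing link, it is `1` for that link. -/
  turn : Road → Road → ℝ
  turn_nonneg : ∀ j k, 0 ≤ turn j k
  turn_adj : ∀ j k, turn j k ≠ 0 → ∃ v, target j = some v ∧ source k = some v
  turn_sum : ∀ j v, target j = some v → ∑ k, turn j k = 1
  /-- The signal split of a link: the share of green time in each cycle. -/
  split : Road → ℝ
  split_pos : ∀ j, 0 < split j
  split_sum : ∀ j v, target j = some v → (∑ i, if target i = some v then split i else 0) = 1
  /-- There is no signal where a link leaves the network. -/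
  split_exit : ∀ j, target j = none → split j = 1
  /-- The density at time `0`. -/
  density0 : Road → ℝ → ℝ
  measurable_density0 : ∀ k, Measurable (density0 k)
  density0_mem : ∀ k x, density0 k x ∈ Icc 0 (link k).jam
  /-- The rate at which vehicles arrive from outside (used for entering links only). -/
  arrival : Road → ℝ → ℝ
  measurable_arrival : ∀ k, Measurable (arrival k)
  arrival_nonneg : ∀ k t, 0 ≤ arrival k t

namespace SignalNetwork

variable {Road Node : Type*} [Fintype Road] [DecidableEq Node] (net : SignalNetwork Road Node)

/-- `D_k(t)`. -/
def exitDemand (N : Road → ℝ → ℝ → ℝ) (k : Road) (t : ℝ) : ℝ :=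
  (net.link k).demand ((net.link k).exitDensity (N k) t)

/-- `S_k(t)`. -/
def entranceSupply (N : Road → ℝ → ℝ → ℝ) (k : Road) (t : ℝ) : ℝ :=
  (net.link k).supply ((net.link k).entranceDensity (N k) t)

/-- The effective supply available to link `j`: the least of its capacity `C_j` and of the numbers
`S_k(t) / turn j k` for the links `k` that its traffic enters. At a merge into a link `k` this is
`min C_j (S_k(t))`; for a link that leaves the network it is `C_j`. -/
def effectiveSupply (N : Road → ℝ → ℝ → ℝ) (j : Road) (t : ℝ) : ℝ :=
  (Finset.univ.filter fun k => 0 < net.turn j k).fold min (net.link j).capacity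
    fun k => net.entranceSupply N k t / net.turn j k

/-- The exit flow of a link when the supply is multiplied by the control `g`, which is the on-off
signal in one model and the constant split in the other. -/
def exitFlow (g : Road → ℝ → ℝ) (N : Road → ℝ → ℝ → ℝ) (j : Road) (t : ℝ) : ℝ :=
  min (net.exitDemand N j t) (net.effectiveSupply N j t * g j t)

/-- The entrance flow of a link: the sum of the exit flows that turn into it or, for a link that
enters the network, the least of arrival rate and supply. -/
def entranceFlow (g : Road → ℝ → ℝ) (N : Road → ℝ → ℝ → ℝ) (k : Road) (t : ℝ) : ℝ :=
  if net.source k = none then min (net.arrival k t) (net.entranceSupply N k t)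
  else ∑ j, net.turn j k * net.exitFlow g N j t

/-- `N`, one Moskowitz function for each link, is a solution on the network up to time `T` under
the control `g`. Vehicles are counted from the entrance of each link at time `0`. -/
structure IsSolution (T : ℝ) (g : Road → ℝ → ℝ) (N : Road → ℝ → ℝ → ℝ) : Prop where
  solvesHJ : ∀ k, (net.link k).SolvesHJ T (N k)
  initial : ∀ k, ∀ x ∈ Icc (net.link k).a (net.link k).b,
    N k 0 x = -∫ ξ in (net.link k).a..x, net.density0 k ξ
  entranceDensity : ∀ k, ∀ᵐ t, t ∈ Icc 0 T → (net.link k).HasEntranceDensity (N k) t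
  exitDensity : ∀ k, ∀ᵐ t, t ∈ Icc 0 T → (net.link k).HasExitDensity (N k) t
  integrable_exitFlow : ∀ k, IntervalIntegrable (net.exitFlow g N k) volume 0 T
  integrable_entranceFlow : ∀ k, IntervalIntegrable (net.entranceFlow g N k) volume 0 T
  exit_count : ∀ k, ∀ t ∈ Icc 0 T, N k t (net.link k).b - N k 0 (net.link k).b =
    ∫ s in (0 : ℝ)..t, net.exitFlow g N k s
  entrance_count : ∀ k, ∀ t ∈ Icc 0 T, N k t (net.link k).a - N k 0 (net.link k).a =
    ∫ s in (0 : ℝ)..t, net.entranceFlow g N k s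

/-- The entrance of every link remains in the uncongested phase. -/
def NoSpillback (T : ℝ) (N : Road → ℝ → ℝ → ℝ) : Prop :=
  ∀ k, ∀ᵐ t, t ∈ Icc 0 T →
    (net.link k).Uncongested ((net.link k).entranceDensity (N k) t)

/-- `u` is a fixed-cycle-and-split signal control with cycle length `Δ v` at intersection `v`:
each link that ends at `v` has in every cycle one green phase, of length `split * Δ v`, and is red
in the rest of the cycle, and at every time exactly one link that ends at `v` has green. -/
structure IsOnOffControl (Δ : Node → ℝ) (u : Road → ℝ → ℝ) : Prop where
  periodic : ∀ j v, net.target j = some v → ∃ θ : ℝ, ∀ t,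
    u j t = if Int.fract ((t - θ) / Δ v) < net.split j then 1 else 0
  one_green : ∀ j v, net.target j = some v → ∀ t,
    (∑ i, if net.target i = some v then u i t else 0) = 1
  exit : ∀ j, net.target j = none → ∀ t, u j t = 1

/-- The control of the continuum signal model: the constant split. -/
def continuumControl : Road → ℝ → ℝ := fun j _ => net.split j

end SignalNetwork

end

/-! Without spillback every supply equals a capacity, so the effective supply of link `j` is a
constant `freeSupply j`, the same in both models. Each link then behaves as a queue. The free costs
at its exit bound the exit count by what its initial and entrance data allow. While the exit count
stays strictly below them, the density at the exit is congested or the flow is already the capacity,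
so the exit flow is exactly `freeSupply j * g j` (`ae_exitFlow_eq_of_queue`).

Two such queues are compared from the last time at which the second one touched its free costs. At
that time the counts are ordered up to the deviation of the entrance data, and afterwards up to the
deviation of the cumulative controls (`queue_le_add`, `exit_le_add`). For signal against split this
deviation is at most one cycle.

The network may contain loops, so the estimate is propagated in time steps `h`. Waves may be
arbitrarily fast when `f` is steep at `0`, so there need not be a positive minimal travel time.
Still, entries during the last `h` time units matter only up to `h * f*((b - a) / h)`, which is
`o(h)`. Turning fractions out of a link sum to at most one, so errors add up over the `O(T / h)`
steps instead of being amplified (`sum_exitError_le`). Fixing `h` first and then taking cycles that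
are small compared with `h` makes the total small. Since episolutions depend on their value
condition nonexpansively, the bound on the boundaries extends to the interior of the links. -/

namespace RoadLink

variable (L : RoadLink)

/-! ### Fundamental diagram and its concave transform. -/

lemma zero_mem : (0 : ℝ) ∈ Icc 0 L.jam := ⟨le_rfl, L.jam_pos.le⟩

lemma jam_mem : L.jam ∈ Icc 0 L.jam := ⟨L.jam_pos.le, le_rfl⟩

lemma le_capacity {r : ℝ} (hr : r ∈ Icc 0 L.jam) : L.f r ≤ L.capacity :=
  le_csSup (isCompact_Icc.image_of_continuousOn L.continuousOn_f).bddAbove (mem_image_of_mem _ hr)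

lemma exists_eq_capacity : ∃ r ∈ Icc 0 L.jam, L.f r = L.capacity :=
  (isCompact_Icc.image_of_continuousOn L.continuousOn_f).sSup_mem
    ⟨_, mem_image_of_mem _ L.zero_mem⟩

lemma capacity_nonneg : 0 ≤ L.capacity := L.f_zero ▸ L.le_capacity L.zero_mem

lemma f_nonneg {r : ℝ} (hr : r ∈ Icc 0 L.jam) : 0 ≤ L.f r := by
  have h := L.concaveOn_f.min_le_of_mem_Icc L.zero_mem L.jam_mem hr
  simpa [L.f_zero, L.f_jam] using h

lemma demand_nonneg {r : ℝ} (hr : r ∈ Icc 0 L.jam) : 0 ≤ L.demand r := by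
  unfold demand
  split_ifs
  exacts [L.f_nonneg hr, L.capacity_nonneg]

lemma continuousOn_sub_mul (u : ℝ) : ContinuousOn (fun r => L.f r - u * r) (Icc 0 L.jam) :=
  L.continuousOn_f.sub (by fun_prop)

lemma le_fStar {r : ℝ} (hr : r ∈ Icc 0 L.jam) (u : ℝ) : L.f r - u * r ≤ L.fStar u :=
  le_csSup (isCompact_Icc.image_of_continuousOn (L.continuousOn_sub_mul u)).bddAbove
    (mem_image_of_mem (fun r => L.f r - u * r) hr)

lemma exists_eq_fStar (u : ℝ) : ∃ r ∈ Icc 0 L.jam, L.f r - u * r = L.fStar u :=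
  (isCompact_Icc.image_of_continuousOn (L.continuousOn_sub_mul u)).sSup_mem
    ⟨_, mem_image_of_mem _ L.zero_mem⟩

lemma fStar_nonneg (u : ℝ) : 0 ≤ L.fStar u := by
  simpa [L.f_zero] using L.le_fStar L.zero_mem u

lemma fStar_le_add (u v : ℝ) : L.fStar u ≤ L.fStar v + L.jam * |u - v| := by
  obtain ⟨r, hr, h⟩ := L.exists_eq_fStar u
  have h1 := L.le_fStar hr v
  have h2 : (v - u) * r ≤ |u - v| * L.jam := by
    refine (le_abs_self _).trans ?_
    rw [abs_mul, abs_sub_comm v u, abs_of_nonneg hr.1]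
    exact mul_le_mul_of_nonneg_left hr.2 (abs_nonneg _)
  linarith

lemma continuous_fStar : Continuous L.fStar := by
  have : LipschitzWith ⟨L.jam, L.jam_pos.le⟩ L.fStar :=
    LipschitzWith.of_le_add_mul _ fun u v => by
      rw [Real.dist_eq]; exact L.fStar_le_add u v
  exact this.continuous

lemma intervalIntegrable_fStar {τ : ℝ} {u : ℝ → ℝ} (hu : IntervalIntegrable u volume 0 τ) :
    IntervalIntegrable (fun s => L.fStar (u s)) volume 0 τ := by
  have hb : IntervalIntegrable (fun s => L.fStar 0 + L.jam * |u s|) volume 0 τ :=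
    intervalIntegrable_const.add (hu.abs.const_mul _)
  refine hb.mono_fun (L.continuous_fStar.comp_aestronglyMeasurable
    hu.def'.aestronglyMeasurable) (Filter.Eventually.of_forall fun s => ?_)
  have h := L.fStar_le_add (u s) 0
  rw [sub_zero] at h
  simp only [Real.norm_eq_abs]
  rw [abs_of_nonneg (L.fStar_nonneg _)]
  exact h.trans (le_abs_self _)

/-- The Fenchel inequality integrated along a control. With `r` optimal for the mean speed it does
the work of Jensen's inequality, so straight evolutions are cheapest. -/
lemma sub_mul_le_integral_fStar {τ r : ℝ} {u : ℝ → ℝ} (hτ : 0 ≤ τ)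
    (hu : IntervalIntegrable u volume 0 τ) (hr : r ∈ Icc 0 L.jam) :
    τ * L.f r - (∫ s in (0 : ℝ)..τ, u s) * r ≤ ∫ s in (0 : ℝ)..τ, L.fStar (u s) := by
  have h1 : IntervalIntegrable (fun s => L.f r - u s * r) volume 0 τ :=
    intervalIntegrable_const.sub (hu.mul_const _)
  have h2 := intervalIntegral.integral_mono_on hτ h1 (L.intervalIntegrable_fStar hu)
    fun s _ => L.le_fStar hr (u s)
  rw [intervalIntegral.integral_sub intervalIntegrable_const (hu.mul_const _)] at h2
  simpa using h2

/-- For fixed `r`, the quantity `s * f r - l * r` is nondecreasing in `s` because `f ≥ 0`; the left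
side is its maximum over `r`. -/
lemma mul_fStar_div_le {l s h : ℝ} (hs : 0 < s) (hsh : s ≤ h) :
    s * L.fStar (l / s) ≤ h * L.fStar (l / h) := by
  obtain ⟨r, hr, he⟩ := L.exists_eq_fStar (l / s)
  have h1 := L.le_fStar hr (l / h)
  have hh : 0 < h := hs.trans_le hsh
  have e1 : s * (L.f r - l / s * r) = s * L.f r - l * r := by field_simp
  have e2 : h * (L.f r - l / h * r) = h * L.f r - l * r := by field_simp
  have h3 := mul_le_mul_of_nonneg_left h1 hh.le
  have h4 := mul_le_mul_of_nonneg_right hsh (L.f_nonneg hr)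
  rw [← he, e1]
  linarith

/-- Densities near `0` carry little flow, and for the others the term `u * r` eventually exceeds the
capacity. This makes the effect of a short lag `o(h)` even when `f` has infinite slope at `0`. -/
lemma tendsto_fStar_atTop : Filter.Tendsto L.fStar Filter.atTop (nhds 0) := by
  rw [Metric.tendsto_atTop]
  intro ε hε
  have hc : ContinuousWithinAt L.f (Icc 0 L.jam) 0 := L.continuousOn_f 0 L.zero_mem
  obtain ⟨δ, hδ, hf⟩ := Metric.continuousWithinAt_iff.1 hc ε hε
  refine ⟨L.capacity / δ, fun u hu => ?_⟩
  have hu0 : 0 ≤ u := (div_nonneg L.capacity_nonneg hδ.le).trans hu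
  obtain ⟨r, hr, he⟩ := L.exists_eq_fStar u
  rw [Real.dist_eq, sub_zero, abs_of_nonneg (L.fStar_nonneg u), ← he]
  by_cases hrd : r < δ
  · have := hf hr (by rwa [Real.dist_eq, sub_zero, abs_of_nonneg hr.1])
    rw [L.f_zero, Real.dist_eq, sub_zero, abs_of_nonneg (L.f_nonneg hr)] at this
    nlinarith [mul_nonneg hu0 hr.1]
  · have h1 : L.capacity ≤ u * δ := (div_le_iff₀ hδ).1 hu
    have h2 := mul_le_mul_of_nonneg_left (not_lt.1 hrd) hu0
    have := L.le_capacity hr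
    linarith

/-! ### Episolutions and free costs at the exit. -/

/-- The straight evolution towards a point of the value domain is admissible. -/
lemma straight_mem_captureCosts {T t x τ x' : ℝ} (c : ℝ → ℝ → ℝ) (ht : t ≤ T)
    (hx : x ∈ Icc L.a L.b) (hx' : x' ∈ Icc L.a L.b) (hτ : 0 < τ) (hτt : τ ≤ t)
    (hv : t - τ = 0 ∨ x' = L.a ∨ x' = L.b) :
    c (t - τ) x' + τ * L.fStar ((x - x') / τ) ∈ L.captureCosts T c t x := by
  have e : x - τ * ((x - x') / τ) = x' := by field_simp; ring
  refine ⟨τ, fun _ => (x - x') / τ, hτ.le, intervalIntegrable_const, fun s hs => ⟨?_, ?_⟩, ?_, ?_⟩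
  · constructor <;> linarith [hs.1, hs.2]
  · have hs1 : s / τ ≤ 1 := (div_le_one hτ).2 hs.2
    have hs0 : 0 ≤ s / τ := div_nonneg hs.1 hτ.le
    have : x - ∫ σ in (0 : ℝ)..s, (x - x') / τ = (1 - s / τ) • x + (s / τ) • x' := by
      simp; field_simp; ring
    rw [this]
    exact (convex_Icc L.a L.b) hx hx' (by linarith) hs0 (by ring)
  · simp only [intervalIntegral.integral_const, sub_zero, smul_eq_mul, e]
    exact ⟨⟨by linarith, by simp only; linarith⟩, hx', hv⟩
  · simp only [intervalIntegral.integral_const, sub_zero, smul_eq_mul, e]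

/-- The episolution depends on the value condition in a nonexpansive way. -/
lemma SolvesHJ.le_add {L : RoadLink} {T B : ℝ} {N N' : ℝ → ℝ → ℝ} (h : L.SolvesHJ T N)
    (h' : L.SolvesHJ T N') (hB : ∀ p ∈ L.valueDomain T, N p.1 p.2 ≤ N' p.1 p.2 + B)
    {t x : ℝ} (ht : t ∈ Icc 0 T) (hx : x ∈ Icc L.a L.b) : N t x ≤ N' t x + B := by
  suffices N t x - B ≤ N' t x by linarith
  refine (h' t ht x hx).2 ?_
  rintro y ⟨τ, u, hτ, hu, hin, hv, rfl⟩
  have h1 := (h t ht x hx).1 ⟨τ, u, hτ, hu, hin, hv, rfl⟩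
  have h2 := hB _ hv
  simp only at h2
  linarith

/-- The costs of the straight evolutions from the exit to the initial line and to the upstream
boundary. -/
noncomputable def freeCosts (N : ℝ → ℝ → ℝ) (t : ℝ) : Set ℝ :=
  {y | ∃ τ x, 0 < τ ∧ τ ≤ t ∧ x ∈ Icc L.a L.b ∧ (t - τ = 0 ∨ x = L.a) ∧
    y = N (t - τ) x + τ * L.fStar ((L.b - x) / τ)}

lemma b_mem : L.b ∈ Icc L.a L.b := ⟨L.a_lt_b.le, le_rfl⟩

lemma a_mem : L.a ∈ Icc L.a L.b := ⟨le_rfl, L.a_lt_b.le⟩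

lemma SolvesHJ.le_freeCosts {L : RoadLink} {T : ℝ} {N : ℝ → ℝ → ℝ} (h : L.SolvesHJ T N) {t : ℝ}
    (ht : t ∈ Icc 0 T) {y : ℝ} (hy : y ∈ L.freeCosts N t) : N t L.b ≤ y := by
  obtain ⟨τ, x, hτ, hτt, hx, hv, rfl⟩ := hy
  exact (h t ht _ L.b_mem).1
    (L.straight_mem_captureCosts N ht.2 L.b_mem hx hτ hτt (hv.imp_right Or.inl))

/-- Comparison of free costs: the flow that has entered within the last `h` time units contributes
at most `h * f*((b - a) / h)`. -/
lemma SolvesHJ.le_freeCosts_add {L : RoadLink} {T B h : ℝ} {N N' : ℝ → ℝ → ℝ}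
    (hN : L.SolvesHJ T N) (h0 : ∀ x ∈ Icc L.a L.b, N 0 x = N' 0 x)
    (hmono : MonotoneOn (fun t => N' t L.a) (Icc 0 T)) (hh : 0 < h) {t : ℝ} (ht : t ∈ Icc 0 T)
    (hB0 : 0 ≤ B) (hB : ∀ s ∈ Icc 0 T, s + h ≤ t → N s L.a ≤ N' s L.a + B)
    {y : ℝ} (hy : y ∈ L.freeCosts N' t) :
    N t L.b ≤ y + (B + h * L.fStar ((L.b - L.a) / h)) := by
  obtain ⟨τ, x, hτ, hτt, hx, hv, rfl⟩ := hy
  have hp : 0 ≤ h * L.fStar ((L.b - L.a) / h) := mul_nonneg hh.le (L.fStar_nonneg _)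
  have hp' : 0 ≤ τ * L.fStar ((L.b - x) / τ) := mul_nonneg hτ.le (L.fStar_nonneg _)
  have hfree := hN.le_freeCosts ht ⟨τ, x, hτ, hτt, hx, hv, rfl⟩
  by_cases hz : t - τ = 0
  · rw [hz, h0 x hx] at hfree
    rw [hz]
    linarith
  have hxa : x = L.a := hv.resolve_left hz
  subst hxa
  by_cases hhτ : h ≤ τ
  · linarith [hB (t - τ) ⟨by linarith, by linarith [ht.2]⟩ (by linarith)]
  push Not at hhτ
  -- A late entry is replaced by one at the earlier time `t - τ'`, where the entrance counts are
  -- already comparable, or where `t - τ' = 0` and they coincide. Monotonicity of `N'` at the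
  -- entrance then leads back to `t - τ`.
  set τ' := min h t with hτ'
  have htp : 0 < t := hτ.trans_le hτt
  have hτ'0 : 0 < τ' := lt_min hh htp
  have hfree' := hN.le_freeCosts ht ⟨τ', L.a, hτ'0, min_le_right _ _, L.a_mem, Or.inr rfl, rfl⟩
  have h1 := L.mul_fStar_div_le (l := L.b - L.a) hτ'0 (min_le_left h t)
  have h2 : N (t - τ') L.a ≤ N' (t - τ') L.a + B := by
    rcases le_total h t with hc | hc
    · rw [hτ', min_eq_left hc]
      exact hB _ ⟨by linarith, by linarith [ht.2]⟩ (by linarith)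
    · rw [hτ', min_eq_right hc, sub_self, h0 _ L.a_mem]
      linarith
  have h3 : N' (t - τ') L.a ≤ N' (t - τ) L.a :=
    hmono ⟨by linarith [min_le_right h t], by linarith [ht.2]⟩
      ⟨by linarith, by linarith [ht.2]⟩ (by linarith [le_min hhτ.le hτt])
  linarith

/-! ### Congestion at the exit of a queue. -/

/-- Where the count at the exit stays below the free costs, a flow less than the capacity goes
with a congested density. -/
lemma SolvesHJ.not_uncongested_exitDensity {L : RoadLink} {T r q ε : ℝ} {N : ℝ → ℝ → ℝ}
    (h : L.SolvesHJ T N) (hr : r ∈ Ioc 0 T) (hd : L.HasExitDensity N r) (hε : 0 < ε)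
    (hfree : ∀ y ∈ L.freeCosts N r, N r L.b + ε ≤ y)
    (hcap : ∀ s ∈ Icc 0 T, ∀ t ∈ Icc 0 T, s ≤ t → N t L.b - N s L.b ≤ L.capacity * (t - s))
    (hq : HasDerivWithinAt (fun t => N t L.b) q (Iic r) r) (hq0 : 0 ≤ q) (hqC : q < L.capacity) :
    ¬ L.Uncongested (L.exitDensity N r) := by
  obtain ⟨ρc, hρc, hfc⟩ := L.exists_eq_capacity
  set e := (L.capacity - q) / 2 with he
  have he0 : 0 < e := by rw [he]; linarith
  -- A density beyond the critical one whose flow lies strictly between `q` and the capacity. The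
  -- exit density will turn out to be at least `ρ`, and monotonicity of `f` up to there would force
  -- `f ρ` to be at least the capacity.
  obtain ⟨ρ, hρ, hfρ⟩ : ∃ ρ ∈ Icc ρc L.jam, L.f ρ = q + e := by
    have := intermediate_value_Icc' hρc.2 (L.continuousOn_f.mono (Icc_subset_Icc_left hρc.1))
    refine this ⟨?_, ?_⟩
    · rw [L.f_jam]; linarith
    · rw [hfc]; linarith
  have hρm : ρ ∈ Icc 0 L.jam := ⟨hρc.1.trans hρ.1, hρ.2⟩
  obtain ⟨τ₀, hτ₀, hτ₀r, hdq⟩ : ∃ τ₀, 0 < τ₀ ∧ τ₀ ≤ r ∧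
      ∀ τ ∈ Icc 0 τ₀, N r L.b - (q + e) * τ ≤ N (r - τ) L.b := by
    have h1 := hq.isLittleO.def he0
    rw [eventually_nhdsWithin_iff, Metric.eventually_nhds_iff] at h1
    obtain ⟨δ, hδ, h1⟩ := h1
    refine ⟨min (δ / 2) r, lt_min (by linarith) hr.1, min_le_right _ _, fun τ hτ => ?_⟩
    have hτδ : τ < δ := by linarith [hτ.2.trans (min_le_left _ _)]
    have h2 := h1 (y := r - τ) (by
      rw [Real.dist_eq, sub_sub_cancel_left, abs_neg, abs_of_nonneg hτ.1]; exact hτδ)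
      (by simpa using hτ.1)
    simp only [sub_sub_cancel_left, Real.norm_eq_abs, abs_neg, abs_of_nonneg hτ.1,
      smul_eq_mul] at h2
    linarith [(abs_le.1 h2).1]
  -- Every evolution from `b - y` costs enough. Capture on the initial line or at the entrance has
  -- the margin `ε` of `hfree`. Recent capture at the exit is bounded with the density `ρ`, and
  -- capture before `r - τ₀` with the critical density, which leaves the margin `e * τ₀`.
  have key : ∃ δ > 0, ∀ y ∈ Ioo 0 δ, N r L.b + ρ * y ≤ N r (L.b - y) := by
    set m := min ε (e * τ₀) with hm
    have hm0 : 0 < m := lt_min hε (mul_pos he0 hτ₀)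
    have hj := L.jam_pos
    refine ⟨min (m / L.jam) (L.b - L.a), lt_min (div_pos hm0 hj) (sub_pos.2 L.a_lt_b), ?_⟩
    intro y hy
    have hy1 : y * L.jam ≤ m := ((lt_div_iff₀ hj).1 (hy.2.trans_le (min_le_left _ _))).le
    have hy2 : y < L.b - L.a := hy.2.trans_le (min_le_right _ _)
    have hρy : ρ * y ≤ m := by nlinarith [hρm.2, hy.1]
    have hrT : r ∈ Icc 0 T := ⟨hr.1.le, hr.2⟩
    refine (h r hrT _ ⟨by linarith, by linarith [hy.1]⟩).2 ?_
    rintro _ ⟨τ, u, hτ, hu, hin, ⟨hv1, hv2, hv3⟩, rfl⟩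
    simp only at hv1 hv2 hv3
    set I := ∫ σ in (0 : ℝ)..τ, u σ with hI
    have hcost := fun {r'} hr' => L.sub_mul_le_integral_fStar (r := r') hτ hu hr'
    rw [← hI] at hcost
    set J := ∫ s in (0 : ℝ)..τ, L.fStar (u s) with hJ
    have hcapt : (r - τ = 0 ∨ L.b - y - I = L.a) →
        N r L.b + ρ * y ≤ N (r - τ) (L.b - y - I) + J := by
      intro hc
      have hτ0 : 0 < τ := by
        refine hτ.lt_of_ne fun h0 => ?_
        subst h0
        simp only [hI, intervalIntegral.integral_same, sub_zero] at hc
        rcases hc with hc | hc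
        · linarith [hr.1]
        · linarith
      have hf := hfree _ ⟨τ, L.b - y - I, hτ0, by linarith [hv1.1], hv2, hc, rfl⟩
      -- The optimal density for the straight path from `b` to the point of capture also bounds the
      -- given path from `b - y`; the change of endpoint only contributes `y * r' ≥ 0`.
      obtain ⟨r', hr', he'⟩ := L.exists_eq_fStar ((L.b - (L.b - y - I)) / τ)
      have e1 : τ * L.fStar ((L.b - (L.b - y - I)) / τ) = τ * L.f r' - (y + I) * r' := by
        rw [← he']; field_simp; ring
      have h1 := hcost hr'
      have h2 : 0 ≤ y * r' := mul_nonneg hy.1.le hr'.1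
      rw [e1] at hf
      linarith [min_le_left ε (e * τ₀)]
    rcases hv3 with hc | hc | hc
    · exact hcapt (Or.inl hc)
    · exact hcapt (Or.inr hc)
    · rw [hc]
      have hIy : I = -y := by linarith
      rw [hIy] at hcost
      by_cases hττ : τ ≤ τ₀
      · have h1 := hdq τ ⟨hτ, hττ⟩
        have h2 := hcost hρm
        rw [hfρ] at h2
        linarith
      · push Not at hττ
        have h1 := hdq τ₀ ⟨hτ₀.le, le_rfl⟩
        have h2 := hcost hρc
        rw [hfc] at h2
        have h3 := hcap (r - τ) hv1 (r - τ₀) ⟨by linarith, by linarith [hr.2]⟩ (by linarith)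
        have h4 : 0 ≤ y * ρc := mul_nonneg hy.1.le hρc.1
        have h5 : e * τ₀ = L.capacity * τ₀ - (q + e) * τ₀ := by rw [he]; ring
        linarith [min_le_right ε (e * τ₀)]
  have hρle : ρ ≤ L.exitDensity N r := by
    obtain ⟨δ, hδ, key⟩ := key
    have h1 := hd.1.hasDerivWithinAt
    rw [hasDerivWithinAt_iff_tendsto_slope] at h1
    have h2 : derivWithin (N r) (Iic L.b) L.b ≤ -ρ := by
      have hs : Iic L.b \ {L.b} = Iio L.b := by ext; simp [lt_iff_le_and_ne]
      rw [hs] at h1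
      refine le_of_tendsto h1 ?_
      filter_upwards [Ioo_mem_nhdsLT (show L.b - δ < L.b by linarith)] with x hx
      have h3 := key (L.b - x) ⟨by linarith [hx.2], by linarith [hx.1]⟩
      rw [sub_sub_cancel] at h3
      rw [slope_def_field, div_le_iff_of_neg (by linarith [hx.2])]
      linarith
    unfold exitDensity
    linarith
  intro hu
  have h1 := hu ⟨hρc.1, hρ.1.trans hρle⟩ ⟨hρm.1, hρle⟩ hρ.1
  rw [hfc, hfρ] at h1
  linarith

end RoadLink

/-! ### Cumulative signals and comparison of two queues. -/

/-- The integral of a bounded periodic function of mean zero is bounded by the period. -/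
lemma Function.Periodic.abs_integral_le {g : ℝ → ℝ} {p : ℝ} (hg : Function.Periodic g p)
    (hp : 0 < p) (hm : ∀ s t, IntervalIntegrable g volume s t) (hb : ∀ t, |g t| ≤ 1)
    {θ : ℝ} (h0 : ∫ x in θ..θ + p, g x = 0) (s t : ℝ) : |∫ x in s..t, g x| ≤ p := by
  set n := ⌊(t - s) / p⌋ with hn
  have h1 := hg.intervalIntegral_add_zsmul_eq n s hm
  rw [hg.intervalIntegral_add_eq s θ, h0, smul_zero] at h1
  rw [← intervalIntegral.integral_add_adjacent_intervals (hm s (s + n • p)) (hm _ t), h1, zero_add]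
  have h2 := intervalIntegral.norm_integral_le_of_norm_le_const (a := s + n • p) (b := t) (C := 1)
    (f := g) fun x _ => hb x
  have h3 : (n : ℝ) * p ≤ t - s := (le_div_iff₀ hp).1 (Int.floor_le _)
  have h4 : t - s < (n + 1) * p := (div_lt_iff₀ hp).1 (Int.lt_floor_add_one _)
  rw [zsmul_eq_mul, Real.norm_eq_abs, one_mul, abs_of_nonneg (show 0 ≤ t - (s + n * p) by linarith)] at h2
  rw [zsmul_eq_mul]
  linarith

/-- A signal with green share `η` differs from the constant `η` by at most one cycle in the
cumulative green time. -/
lemma abs_integral_signal_sub_le {η p θ : ℝ} (hp : 0 < p) (hη0 : 0 ≤ η) (hη1 : η ≤ 1) (s t : ℝ) :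
    |∫ x in s..t, ((if Int.fract ((x - θ) / p) < η then (1 : ℝ) else 0) - η)| ≤ p := by
  have hb : ∀ x, |(if Int.fract ((x - θ) / p) < η then (1 : ℝ) else 0) - η| ≤ 1 := by
    intro x
    rw [abs_le]
    split_ifs <;> constructor <;> linarith
  have hmeas : Measurable fun x => (if Int.fract ((x - θ) / p) < η then (1 : ℝ) else 0) - η := by
    refine (Measurable.ite ?_ measurable_const measurable_const).sub_const _
    exact measurableSet_lt (by fun_prop) measurable_const
  have hint : ∀ s t, IntervalIntegrable
      (fun x => (if Int.fract ((x - θ) / p) < η then (1 : ℝ) else 0) - η) volume s t := fun s t =>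
    (intervalIntegrable_const (c := (1 : ℝ))).mono_fun hmeas.aestronglyMeasurable
      (Filter.Eventually.of_forall fun x => by simpa using hb x)
  have hper : Function.Periodic
      (fun x => (if Int.fract ((x - θ) / p) < η then (1 : ℝ) else 0) - η) p := by
    intro x
    have : (x + p - θ) / p = (x - θ) / p + 1 := by field_simp; ring
    simp only [this, Int.fract_add_one]
  refine hper.abs_integral_le hp hint hb (θ := θ) ?_ s t
  have hmul : 0 ≤ η * p := mul_nonneg hη0 hp.le
  have hmul' : η * p ≤ p := by nlinarith
  have hfr : ∀ x ∈ Ioo θ (θ + p), Int.fract ((x - θ) / p) = (x - θ) / p := fun x hx =>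
    Int.fract_eq_self.2 ⟨div_nonneg (by linarith [hx.1]) hp.le,
      (div_lt_one hp).2 (by linarith [hx.2])⟩
  rw [← intervalIntegral.integral_add_adjacent_intervals (hint θ (θ + η * p)) (hint _ (θ + p))]
  have e1 : ∫ x in θ..θ + η * p, ((if Int.fract ((x - θ) / p) < η then (1 : ℝ) else 0) - η)
      = ∫ x in θ..θ + η * p, (1 - η) := by
    refine intervalIntegral.integral_congr_Ioo_of_le (by linarith) fun x hx => ?_
    rw [hfr x ⟨hx.1, by linarith [hx.2]⟩, if_pos ((div_lt_iff₀ hp).2 (by linarith [hx.2]))]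
  have e2 : ∫ x in θ + η * p..θ + p, ((if Int.fract ((x - θ) / p) < η then (1 : ℝ) else 0) - η)
      = ∫ x in θ + η * p..θ + p, (0 - η) := by
    refine intervalIntegral.integral_congr_Ioo_of_le (by linarith) fun x hx => ?_
    rw [hfr x ⟨by linarith [hx.1], hx.2⟩, if_neg]
    rw [not_lt, le_div_iff₀ hp]
    linarith [hx.1]
  rw [e1, e2]
  simp
  ring

/-- Two queues: the counts `Z₁`, `Z₂` grow at rates at most `w₁`, `w₂`, with equality for `Z₂` as
long as it stays below its free costs `F`. -/
lemma queue_le_add {t β κ : ℝ} {Z₁ Z₂ w₁ w₂ q : ℝ → ℝ} {F : ℝ → Set ℝ} (ht : 0 ≤ t)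
    (hβ : 0 ≤ β) (h0 : Z₁ 0 = Z₂ 0) (hc₁ : ContinuousOn Z₁ (Icc 0 t))
    (hc₂ : ContinuousOn Z₂ (Icc 0 t))
    (h₁ : ∀ s ∈ Icc 0 t, Z₁ t - Z₁ s ≤ ∫ x in s..t, w₁ x)
    (h₂ : ∀ s ∈ Icc 0 t, Z₂ t - Z₂ s = ∫ x in s..t, q x)
    (hq : ∀ᵐ r, r ∈ Ioc 0 t → (∃ ε > 0, ∀ y ∈ F r, Z₂ r + ε ≤ y) → q r = w₂ r)
    (hF : ∀ s ∈ Icc 0 t, ∀ y ∈ F s, Z₁ s ≤ y + β)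
    (hw : ∀ s ∈ Icc 0 t, ∫ x in s..t, w₁ x ≤ (∫ x in s..t, w₂ x) + κ) :
    Z₁ t ≤ Z₂ t + (β + κ) := by
  -- The times at which `Z₂` is not separated from its free costs. Time `0` is added so that `S` is
  -- nonempty; there the counts agree. `S` need not be closed, so its supremum is handled through
  -- the continuity of the counts.
  set S : Set ℝ := insert 0 {s | s ∈ Icc 0 t ∧ ∀ ε > 0, ∃ y ∈ F s, y < Z₂ s + ε} with hS
  have hSt : S ⊆ Icc 0 t := insert_subset ⟨le_rfl, ht⟩ fun s hs => hs.1
  have hne : S.Nonempty := ⟨0, mem_insert _ _⟩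
  have hbdd : BddAbove S := ⟨t, fun s hs => (hSt hs).2⟩
  have hle : ∀ s ∈ S, Z₁ s - Z₂ s ≤ β := by
    intro s hs
    rcases hs with rfl | hs
    · linarith
    · refine le_of_forall_pos_le_add fun ε hε => ?_
      obtain ⟨y, hy, hlt⟩ := hs.2 ε hε
      linarith [hF s hs.1 y hy]
  have hcl : sSup S ∈ closure S := csSup_mem_closure hne hbdd
  have hmem : sSup S ∈ Icc 0 t := isClosed_Icc.closure_subset_iff.2 hSt hcl
  have hsup : Z₁ (sSup S) - Z₂ (sSup S) ≤ β := by
    have hcont := ((hc₁.sub hc₂) _ hmem).mono hSt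
    have := hcont.mem_closure hcl (t := Iic β) hle
    rwa [closure_Iic] at this
  have heq : ∫ x in sSup S..t, q x = ∫ x in sSup S..t, w₂ x := by
    refine intervalIntegral.integral_congr_ae ?_
    filter_upwards [hq] with r hr hrm
    rw [uIoc_of_le hmem.2] at hrm
    refine hr ⟨hmem.1.trans_lt hrm.1, hrm.2⟩ ?_
    by_contra! hcon
    exact not_le.2 hrm.1 (le_csSup hbdd (Or.inr ⟨⟨hmem.1.trans hrm.1.le, hrm.2⟩, hcon⟩))
  linarith [h₁ _ hmem, h₂ _ hmem, hw _ hmem]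

/-! ### Supplies and flows without spillback. -/

namespace SignalNetwork

variable {Road Node : Type*} [Fintype Road] [DecidableEq Node] (net : SignalNetwork Road Node)

/-- The effective supply when all the links downstream can be entered at capacity. -/
noncomputable def freeSupply (j : Road) : ℝ :=
  (Finset.univ.filter fun k => 0 < net.turn j k).fold min (net.link j).capacity
    fun k => (net.link k).capacity / net.turn j k

lemma freeSupply_le_capacity (j : Road) : net.freeSupply j ≤ (net.link j).capacity :=
  Finset.fold_min_le _ |>.2 (Or.inl le_rfl)

lemma freeSupply_nonneg (j : Road) : 0 ≤ net.freeSupply j :=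
  Finset.le_fold_min _ |>.2 ⟨(net.link j).capacity_nonneg, fun k _ =>
    div_nonneg (net.link k).capacity_nonneg (net.turn_nonneg j k)⟩

lemma split_le_one (j : Road) : net.split j ≤ 1 := by
  rcases h : net.target j with _ | v
  · exact (net.split_exit j h).le
  · rw [← net.split_sum j v h]
    have := Finset.single_le_sum (f := fun i => if net.target i = some v then net.split i else 0)
      (fun i _ => by split_ifs; exacts [(net.split_pos i).le, le_rfl]) (Finset.mem_univ j)
    simpa [h] using this

lemma continuumControl_mem (j : Road) (t : ℝ) : net.continuumControl j t ∈ Icc 0 1 :=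
  ⟨(net.split_pos j).le, net.split_le_one j⟩

variable {net} {T : ℝ} {g : Road → ℝ → ℝ} {N : Road → ℝ → ℝ → ℝ}

lemma IsOnOffControl.mem {Δ : Node → ℝ} {u : Road → ℝ → ℝ} (hu : net.IsOnOffControl Δ u)
    (j : Road) (t : ℝ) : u j t ∈ Icc 0 1 := by
  rcases h : net.target j with _ | v
  · simp [hu.exit j h t]
  · obtain ⟨θ, hθ⟩ := hu.periodic j v h
    rw [hθ]
    split_ifs <;> simp

lemma IsOnOffControl.measurable {Δ : Node → ℝ} {u : Road → ℝ → ℝ} (hu : net.IsOnOffControl Δ u)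
    (j : Road) : Measurable (u j) := by
  rcases h : net.target j with _ | v
  · rw [funext (hu.exit j h)]
    exact measurable_const
  · obtain ⟨θ, hθ⟩ := hu.periodic j v h
    rw [funext hθ]
    exact Measurable.ite (measurableSet_lt (by fun_prop) measurable_const) measurable_const
      measurable_const

lemma IsOnOffControl.abs_integral_sub_split_le {Δ : Node → ℝ} {u : Road → ℝ → ℝ} {δ : ℝ}
    (hu : net.IsOnOffControl Δ u) (hδ : 0 ≤ δ) (hΔ : ∀ v, 0 < Δ v ∧ Δ v < δ) (j : Road)
    (s t : ℝ) : |∫ x in s..t, (u j x - net.split j)| ≤ δ := by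
  rcases h : net.target j with _ | v
  · simp [hu.exit j h, net.split_exit j h, hδ]
  · obtain ⟨θ, hθ⟩ := hu.periodic j v h
    simp only [hθ]
    exact (abs_integral_signal_sub_le (hΔ v).1 (net.split_pos j).le (net.split_le_one j) s t).trans
      (hΔ v).2.le

lemma NoSpillback.ae_entranceSupply_eq (h : net.NoSpillback T N) :
    ∀ᵐ t, t ∈ Icc 0 T → ∀ k, net.entranceSupply N k t = (net.link k).capacity := by
  filter_upwards [ae_all_iff.2 h] with t ht hm k
  exact if_pos (ht k hm)

lemma NoSpillback.ae_exitFlow_eq (h : net.NoSpillback T N) (g : Road → ℝ → ℝ) :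
    ∀ᵐ t, t ∈ Icc 0 T → ∀ j,
      net.exitFlow g N j t = min (net.exitDemand N j t) (net.freeSupply j * g j t) := by
  filter_upwards [h.ae_entranceSupply_eq] with t ht hm j
  simp only [exitFlow, effectiveSupply, freeSupply, ht hm]

namespace IsSolution

lemma ae_exitFlow_nonneg (hN : net.IsSolution T g N) (hs : net.NoSpillback T N)
    (hg : ∀ j t, g j t ∈ Icc 0 1) : ∀ᵐ t, t ∈ Icc 0 T → ∀ j, 0 ≤ net.exitFlow g N j t := by
  filter_upwards [hs.ae_exitFlow_eq g, ae_all_iff.2 hN.exitDensity] with t h1 h2 hm j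
  rw [h1 hm]
  exact le_min ((net.link j).demand_nonneg (h2 j hm).2)
    (mul_nonneg (net.freeSupply_nonneg j) (hg j t).1)

lemma ae_entranceFlow_nonneg (hN : net.IsSolution T g N) (hs : net.NoSpillback T N)
    (hg : ∀ j t, g j t ∈ Icc 0 1) (k : Road) :
    ∀ᵐ t, t ∈ Icc 0 T → 0 ≤ net.entranceFlow g N k t := by
  filter_upwards [hs.ae_entranceSupply_eq, hN.ae_exitFlow_nonneg hs hg] with t h1 h2 hm
  unfold entranceFlow
  split_ifs
  · exact le_min (net.arrival_nonneg k t) ((h1 hm k).symm ▸ (net.link k).capacity_nonneg)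
  · exact Finset.sum_nonneg fun j _ => mul_nonneg (net.turn_nonneg j k) (h2 hm j)

lemma intervalIntegrable_exitFlow (hN : net.IsSolution T g N) (j : Road) {s t : ℝ}
    (hs : s ∈ Icc 0 T) (ht : t ∈ Icc 0 T) :
    IntervalIntegrable (net.exitFlow g N j) volume s t :=
  (hN.integrable_exitFlow j).mono_set (by
    rw [uIcc_of_le (hs.1.trans hs.2)]
    exact ordConnected_Icc.uIcc_subset hs ht)

lemma exit_sub (hN : net.IsSolution T g N) (j : Road) {s t : ℝ}
    (hs : s ∈ Icc 0 T) (ht : t ∈ Icc 0 T) :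
    N j t (net.link j).b - N j s (net.link j).b = ∫ x in s..t, net.exitFlow g N j x := by
  have h0 : (0 : ℝ) ∈ Icc 0 T := ⟨le_rfl, hs.1.trans hs.2⟩
  rw [← intervalIntegral.integral_interval_sub_left (hN.intervalIntegrable_exitFlow j h0 ht)
    (hN.intervalIntegrable_exitFlow j h0 hs), ← hN.exit_count j t ht, ← hN.exit_count j s hs]
  ring

lemma monotoneOn_entrance (hN : net.IsSolution T g N) (hs : net.NoSpillback T N)
    (hg : ∀ j t, g j t ∈ Icc 0 1) (k : Road) :
    MonotoneOn (fun t => N k t (net.link k).a) (Icc 0 T) := by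
  intro s hsm t htm hst
  have h0 : (0 : ℝ) ∈ Icc 0 T := ⟨le_rfl, hsm.1.trans hsm.2⟩
  have hi : ∀ r ∈ Icc 0 T, IntervalIntegrable (net.entranceFlow g N k) volume 0 r := fun r hr =>
    (hN.integrable_entranceFlow k).mono_set (by
      rw [uIcc_of_le h0.2]
      exact ordConnected_Icc.uIcc_subset h0 hr)
  have h1 := intervalIntegral.integral_interval_sub_left (hi t htm) (hi s hsm)
  have h2 : 0 ≤ ∫ x in s..t, net.entranceFlow g N k x := by
    refine intervalIntegral.integral_nonneg_of_ae_restrict hst ?_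
    refine (ae_restrict_iff' measurableSet_Icc).2 ?_
    filter_upwards [hN.ae_entranceFlow_nonneg hs hg k] with x hx hm
    exact hx ⟨hsm.1.trans hm.1, hm.2.trans htm.2⟩
  rw [← hN.entrance_count k t htm, ← hN.entrance_count k s hsm] at h1
  simp only
  linarith

lemma continuousOn_exit (hN : net.IsSolution T g N) (hT : 0 ≤ T) (j : Road) :
    ContinuousOn (fun t => N j t (net.link j).b) (Icc 0 T) := by
  have h := intervalIntegral.continuousOn_primitive_interval' (hN.integrable_exitFlow j)
    left_mem_uIcc
  rw [uIcc_of_le hT] at h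
  refine (h.const_add (N j 0 (net.link j).b)).congr fun t ht => ?_
  simp only [← hN.exit_count j t ht]
  ring

/-- A link whose exit count is below its free costs discharges at the full rate allowed by the
signal. -/
lemma ae_exitFlow_eq_of_queue (hN : net.IsSolution T g N) (hs : net.NoSpillback T N)
    (hg : ∀ j t, g j t ∈ Icc 0 1) (j : Road) :
    ∀ᵐ r, r ∈ Ioc 0 T →
      (∃ ε > 0, ∀ y ∈ (net.link j).freeCosts (N j) r, N j r (net.link j).b + ε ≤ y) →
      net.exitFlow g N j r = net.freeSupply j * g j r := by
  have hle : ∀ r, net.freeSupply j * g j r ≤ (net.link j).capacity := fun r =>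
    (mul_le_of_le_one_right (net.freeSupply_nonneg j) (hg j r).2).trans
      (net.freeSupply_le_capacity j)
  filter_upwards [hs.ae_exitFlow_eq g, hN.ae_exitFlow_nonneg hs hg, hN.exitDensity j,
    (hN.integrable_exitFlow j).ae_hasDerivAt_integral] with r h1 h2 h3 h4 hr ⟨ε, hε, hfree⟩
  have hr' : r ∈ Icc 0 T := ⟨hr.1.le, hr.2⟩
  have hT : 0 ≤ T := hr'.1.trans hr'.2
  have hqle : net.exitFlow g N j r ≤ net.freeSupply j * g j r :=
    (h1 hr' j).le.trans (min_le_right _ _)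
  by_cases hqC : net.exitFlow g N j r < (net.link j).capacity
  · have hcap : ∀ s ∈ Icc 0 T, ∀ t ∈ Icc 0 T, s ≤ t →
        N j t (net.link j).b - N j s (net.link j).b ≤ (net.link j).capacity * (t - s) := by
      intro s hsm t htm hst
      rw [hN.exit_sub j hsm htm]
      have : ∫ x in s..t, net.exitFlow g N j x ≤ ∫ x in s..t, (net.link j).capacity := by
        refine intervalIntegral.integral_mono_ae_restrict hst
          (hN.intervalIntegrable_exitFlow j hsm htm) intervalIntegrable_const ?_
        refine (ae_restrict_iff' measurableSet_Icc).2 ?_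
        filter_upwards [hs.ae_exitFlow_eq g] with x hx hm
        rw [hx ⟨hsm.1.trans hm.1, hm.2.trans htm.2⟩]
        exact (min_le_right _ _).trans (hle x)
      simpa [mul_comm] using this
    -- A left derivative suffices, and it covers `r = T`, beyond which the count is not prescribed.
    have hd : HasDerivWithinAt (fun t => N j t (net.link j).b) (net.exitFlow g N j r) (Iic r) r := by
      have h5 := ((h4 (by rwa [uIcc_of_le hT]) 0 left_mem_uIcc).const_add
        (N j 0 (net.link j).b)).hasDerivWithinAt (s := Iic r)
      have he : ∀ t ∈ Icc 0 T, N j t (net.link j).b =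
          N j 0 (net.link j).b + ∫ x in (0 : ℝ)..t, net.exitFlow g N j x := fun t ht => by
        rw [← hN.exit_count j t ht]; ring
      refine h5.congr_of_eventuallyEq ?_ (he r hr')
      filter_upwards [Ioc_mem_nhdsLE hr.1] with t ht
      exact he t ⟨ht.1.le, ht.2.trans hr.2⟩
    have hu := (hN.solvesHJ j).not_uncongested_exitDensity hr (h3 hr') hε hfree hcap hd
      (h2 hr' j) hqC
    rw [h1 hr' j, exitDemand, RoadLink.demand, if_neg hu]
    exact min_eq_right (hle r)
  -- A flow at capacity is squeezed: `C ≤ q ≤ freeSupply * g ≤ C`.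
  · exact le_antisymm hqle ((hle r).trans (not_lt.1 hqC))

/-! ### Comparison of exit and entrance counts of two solutions. -/

lemma initial_eq {g' : Road → ℝ → ℝ} {N' : Road → ℝ → ℝ → ℝ} (hN : net.IsSolution T g N)
    (hN' : net.IsSolution T g' N') (k : Road) {x : ℝ}
    (hx : x ∈ Icc (net.link k).a (net.link k).b) : N k 0 x = N' k 0 x := by
  rw [hN.initial k x hx, hN'.initial k x hx]

/-- The exit counts of a link under two controls differ by the deviation of the entrance counts
before a lag `h`, a small term in the lag, and the deviation of the cumulative controls. -/
lemma exit_le_add {g' : Road → ℝ → ℝ} {N' : Road → ℝ → ℝ → ℝ} (hN : net.IsSolution T g N)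
    (hN' : net.IsSolution T g' N') (hs : net.NoSpillback T N) (hs' : net.NoSpillback T N')
    (hg : ∀ j t, g j t ∈ Icc 0 1) (hg' : ∀ j t, g' j t ∈ Icc 0 1) (j : Road)
    (hm : Measurable (g j)) (hm' : Measurable (g' j)) {B h δ t : ℝ} (hh : 0 < h)
    (ht : t ∈ Icc 0 T) (hB0 : 0 ≤ B)
    (hB : ∀ s ∈ Icc 0 T, s + h ≤ t → N j s (net.link j).a ≤ N' j s (net.link j).a + B)
    (hδ : ∀ s t, ∫ x in s..t, (g j x - g' j x) ≤ δ) :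
    N j t (net.link j).b ≤ N' j t (net.link j).b +
      (B + h * (net.link j).fStar (((net.link j).b - (net.link j).a) / h) +
        (net.link j).capacity * δ) := by
  have hT : 0 ≤ T := ht.1.trans ht.2
  have hsub : Icc 0 t ⊆ Icc 0 T := Icc_subset_Icc_right ht.2
  have hint : ∀ g : ℝ → ℝ, Measurable g → (∀ t, g t ∈ Icc 0 1) → ∀ s t,
      IntervalIntegrable g volume s t := fun g hm hg s t =>
    (intervalIntegrable_const (c := (1 : ℝ))).mono_fun hm.aestronglyMeasurable
      (Filter.Eventually.of_forall fun x => by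
        simpa [abs_of_nonneg (hg x).1] using (hg x).2)
  have hi := hint _ hm (hg j)
  have hi' := hint _ hm' (hg' j)
  have hδ0 : 0 ≤ δ := by simpa using hδ 0 0
  have hL0 : 0 ≤ h * (net.link j).fStar (((net.link j).b - (net.link j).a) / h) :=
    mul_nonneg hh.le ((net.link j).fStar_nonneg _)
  refine queue_le_add (w₁ := fun x => net.freeSupply j * g j x)
    (w₂ := fun x => net.freeSupply j * g' j x) (q := net.exitFlow g' N' j)
    (Z₁ := fun t => N j t (net.link j).b) (Z₂ := fun t => N' j t (net.link j).b)
    (F := (net.link j).freeCosts (N' j)) ht.1 (add_nonneg hB0 hL0)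
    (hN.initial_eq hN' j (net.link j).b_mem)
    ((hN.continuousOn_exit hT j).mono hsub) ((hN'.continuousOn_exit hT j).mono hsub)
    ?_ (fun s hs => hN'.exit_sub j (hsub hs) ht) ?_ ?_ ?_
  · intro s hsm
    rw [hN.exit_sub j (hsub hsm) ht]
    refine intervalIntegral.integral_mono_ae_restrict hsm.2
      (hN.intervalIntegrable_exitFlow j (hsub hsm) ht) ((hi s t).const_mul _) ?_
    refine (ae_restrict_iff' measurableSet_Icc).2 ?_
    filter_upwards [hs.ae_exitFlow_eq g] with x hx hxm
    rw [hx ⟨hsm.1.trans hxm.1, hxm.2.trans ht.2⟩]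
    exact min_le_right _ _
  · filter_upwards [hN'.ae_exitFlow_eq_of_queue hs' hg' j] with r hr hrm
    exact hr ⟨hrm.1, hrm.2.trans ht.2⟩
  · intro s hsm y hy
    exact (hN.solvesHJ j).le_freeCosts_add (fun x hx => hN.initial_eq hN' j hx)
      (hN'.monotoneOn_entrance hs' hg' j) hh (hsub hsm) hB0
      (fun s' hs' hsh => hB s' hs' (hsh.trans hsm.2)) hy
  · intro s _
    have h1 := hδ s t
    rw [intervalIntegral.integral_sub (hi s t) (hi' s t)] at h1
    simp only [intervalIntegral.integral_const_mul]
    have h2 := mul_le_mul_of_nonneg_left h1 (net.freeSupply_nonneg j)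
    have h3 := mul_le_mul_of_nonneg_right (net.freeSupply_le_capacity j) hδ0
    linarith

lemma entrance_eq_sum (hN : net.IsSolution T g N) {k : Road} (hk : net.source k ≠ none) {t : ℝ}
    (ht : t ∈ Icc 0 T) : N k t (net.link k).a - N k 0 (net.link k).a =
      ∑ j, net.turn j k * (N j t (net.link j).b - N j 0 (net.link j).b) := by
  have h0 : (0 : ℝ) ∈ Icc 0 T := ⟨le_rfl, ht.1.trans ht.2⟩
  rw [hN.entrance_count k t ht]
  simp only [entranceFlow, if_neg hk]
  rw [intervalIntegral.integral_finsetSum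
    fun j _ => (hN.intervalIntegrable_exitFlow j h0 ht).const_mul _]
  simp only [intervalIntegral.integral_const_mul, hN.exit_count _ t ht]

/-- Without spillback the entrance flow is the least of arrival rate and capacity, which does not
involve the control. -/
lemma entrance_eq_of_source_eq_none {g' : Road → ℝ → ℝ} {N' : Road → ℝ → ℝ → ℝ}
    (hN : net.IsSolution T g N) (hN' : net.IsSolution T g' N') (hs : net.NoSpillback T N)
    (hs' : net.NoSpillback T N') {k : Road} (hk : net.source k = none) {t : ℝ}
    (ht : t ∈ Icc 0 T) : N k t (net.link k).a = N' k t (net.link k).a := by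
  have h1 := hN.entrance_count k t ht
  have h2 := hN'.entrance_count k t ht
  have h3 : ∫ s in (0 : ℝ)..t, net.entranceFlow g N k s =
      ∫ s in (0 : ℝ)..t, net.entranceFlow g' N' k s := by
    refine intervalIntegral.integral_congr_ae ?_
    filter_upwards [hs.ae_entranceSupply_eq, hs'.ae_entranceSupply_eq] with x hx hx' hm
    rw [uIoc_of_le ht.1] at hm
    have hxm : x ∈ Icc 0 T := ⟨hm.1.le, hm.2.trans ht.2⟩
    simp only [entranceFlow, if_pos hk, hx hxm, hx' hxm]
  linarith [hN.initial_eq hN' k (net.link k).a_mem]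

/-- Bounds for the deviations of the exit counts carry over to the entrance counts. -/
lemma abs_entrance_sub_le {g' : Road → ℝ → ℝ} {N' : Road → ℝ → ℝ → ℝ}
    (hN : net.IsSolution T g N) (hN' : net.IsSolution T g' N') (hs : net.NoSpillback T N)
    (hs' : net.NoSpillback T N') {e : Road → ℝ} (he : ∀ j, 0 ≤ e j) {t : ℝ} (ht : t ∈ Icc 0 T)
    (h : ∀ j, |N j t (net.link j).b - N' j t (net.link j).b| ≤ e j) (k : Road) :
    |N k t (net.link k).a - N' k t (net.link k).a| ≤ ∑ j, net.turn j k * e j := by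
  by_cases hk : net.source k = none
  · rw [hN.entrance_eq_of_source_eq_none hN' hs hs' hk ht, sub_self, abs_zero]
    exact Finset.sum_nonneg fun j _ => mul_nonneg (net.turn_nonneg j k) (he j)
  · have : N k t (net.link k).a - N' k t (net.link k).a =
        ∑ j, net.turn j k * (N j t (net.link j).b - N' j t (net.link j).b) := by
      have h1 := hN.entrance_eq_sum hk ht
      have h2 := hN'.entrance_eq_sum hk ht
      have h3 := hN.initial_eq hN' k (net.link k).a_mem
      rw [show N k t (net.link k).a - N' k t (net.link k).a =
        (N k t (net.link k).a - N k 0 (net.link k).a) -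
          (N' k t (net.link k).a - N' k 0 (net.link k).a) by rw [h3]; ring, h1, h2,
        ← Finset.sum_sub_distrib]
      refine Finset.sum_congr rfl fun j _ => ?_
      rw [hN.initial_eq hN' j (net.link j).b_mem]
      ring
    rw [this]
    refine (Finset.abs_sum_le_sum_abs _ _).trans (Finset.sum_le_sum fun j _ => ?_)
    rw [abs_mul, abs_of_nonneg (net.turn_nonneg j k)]
    exact mul_le_mul_of_nonneg_left (h j) (net.turn_nonneg j k)

end IsSolution

/-! ### Propagation of errors through the network. -/

variable (net) in
/-- Error bounds for the exit counts after `m` time steps, when each step contributes `β`. -/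
noncomputable def exitError (β : ℝ) : ℕ → Road → ℝ
  | 0, _ => 0
  | m + 1, k => ∑ j, net.turn j k * exitError β m j + β

lemma exitError_nonneg {β : ℝ} (hβ : 0 ≤ β) (m : ℕ) (k : Road) : 0 ≤ net.exitError β m k := by
  induction m generalizing k with
  | zero => exact le_rfl
  | succ m ih =>
    exact add_nonneg (Finset.sum_nonneg fun j _ => mul_nonneg (net.turn_nonneg j k) (ih j)) hβ

variable (net) in
lemma sum_turn_le_one (j : Road) : ∑ k, net.turn j k ≤ 1 := by
  rcases h : net.target j with _ | v
  · have : ∀ k, net.turn j k = 0 := fun k => by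
      by_contra hne
      obtain ⟨v, hv, -⟩ := net.turn_adj j k hne
      simp [h] at hv
    simp [this]
  · exact (net.turn_sum j v h).le

/-- The sum over all links is the right norm: the fractions out of a link sum to at most one, so
each step adds at most `card * β`. The maximum could grow geometrically, since the fractions into a
link may sum to more than one. -/
lemma sum_exitError_le {β : ℝ} (hβ : 0 ≤ β) (m : ℕ) :
    ∑ k, net.exitError β m k ≤ m * (Fintype.card Road * β) := by
  induction m with
  | zero => simp [exitError]
  | succ m ih =>
    simp only [exitError, Finset.sum_add_distrib]
    rw [Finset.sum_comm]
    simp only [← Finset.sum_mul]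
    have h1 : ∑ j, (∑ k, net.turn j k) * net.exitError β m j ≤ ∑ j, net.exitError β m j :=
      Finset.sum_le_sum fun j _ =>
        mul_le_of_le_one_left (exitError_nonneg hβ m j) (net.sum_turn_le_one j)
    push_cast
    simp only [Finset.sum_const, Finset.card_univ, nsmul_eq_mul]
    linarith

lemma exitError_le {β : ℝ} (hβ : 0 ≤ β) (m : ℕ) (k : Road) :
    net.exitError β m k ≤ m * (Fintype.card Road * β) :=
  (Finset.single_le_sum (fun j _ => exitError_nonneg hβ m j) (Finset.mem_univ k)).trans
    (sum_exitError_le hβ m)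

namespace IsSolution

variable {g' : Road → ℝ → ℝ} {N' : Road → ℝ → ℝ → ℝ}

/-- Induction on time steps. Up to `β`, exit counts until `(m + 1) * h` depend only on entrance
counts until `m * h`, hence on earlier exit counts, so loops in the network cause no circularity. -/
lemma abs_exit_sub_le_exitError (hN : net.IsSolution T g N)
    (hN' : net.IsSolution T g' N') (hs : net.NoSpillback T N) (hs' : net.NoSpillback T N')
    (hg : ∀ j t, g j t ∈ Icc 0 1) (hg' : ∀ j t, g' j t ∈ Icc 0 1)
    (hm : ∀ j, Measurable (g j)) (hm' : ∀ j, Measurable (g' j)) {h δ β : ℝ} (hh : 0 < h)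
    (hβ : 0 ≤ β) (hδ : ∀ j s t, |∫ x in s..t, (g j x - g' j x)| ≤ δ)
    (hβl : ∀ j, h * (net.link j).fStar (((net.link j).b - (net.link j).a) / h) +
      (net.link j).capacity * δ ≤ β) (m : ℕ) {t : ℝ} (ht : t ∈ Icc 0 T) (htm : t ≤ m * h)
    (j : Road) :
    |N j t (net.link j).b - N' j t (net.link j).b| ≤ net.exitError β m j := by
  induction m generalizing t j with
  | zero =>
    have : t = 0 := le_antisymm (by simpa using htm) ht.1
    rw [this, hN.initial_eq hN' j (net.link j).b_mem]
    simp [exitError]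
  | succ m ih =>
    push_cast at htm
    have hB0 : 0 ≤ ∑ i, net.turn i j * net.exitError β m i :=
      Finset.sum_nonneg fun i _ => mul_nonneg (net.turn_nonneg i j) (exitError_nonneg hβ m i)
    have hB : ∀ s ∈ Icc 0 T, s + h ≤ t → |N j s (net.link j).a - N' j s (net.link j).a| ≤
        ∑ i, net.turn i j * net.exitError β m i := fun s hsm hst =>
      hN.abs_entrance_sub_le hN' hs hs' (exitError_nonneg hβ m) hsm
        (fun i => ih hsm (by linarith) i) j
    have h1 := hN.exit_le_add hN' hs hs' hg hg' j (hm j) (hm' j) hh ht hB0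
      (fun s hsm hst => by linarith [(abs_le.1 (hB s hsm hst)).2])
      (fun s t => (abs_le.1 (hδ j s t)).2)
    have h2 := hN'.exit_le_add hN hs' hs hg' hg j (hm' j) (hm j) hh ht hB0
      (fun s hsm hst => by linarith [(abs_le.1 (hB s hsm hst)).1])
      -- Exchanging the two controls amounts to reversing the limits of integration.
      (fun s t => by
        have := (abs_le.1 (hδ j t s)).2
        rw [intervalIntegral.integral_symm, ← intervalIntegral.integral_neg] at this
        simpa using this)
    rw [exitError, abs_le]
    constructor <;> linarith [hβl j]

/-- Two solutions without spillback, under controls whose time integrals differ by at most `δ`. -/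
lemma abs_sub_le (hN : net.IsSolution T g N)
    (hN' : net.IsSolution T g' N') (hs : net.NoSpillback T N) (hs' : net.NoSpillback T N')
    (hg : ∀ j t, g j t ∈ Icc 0 1) (hg' : ∀ j t, g' j t ∈ Icc 0 1)
    (hm : ∀ j, Measurable (g j)) (hm' : ∀ j, Measurable (g' j)) {h δ β : ℝ} (hh : 0 < h)
    (hβ : 0 ≤ β) (hδ : ∀ j s t, |∫ x in s..t, (g j x - g' j x)| ≤ δ)
    (hβl : ∀ j, h * (net.link j).fStar (((net.link j).b - (net.link j).a) / h) +
      (net.link j).capacity * δ ≤ β) {m : ℕ} (hmT : T ≤ m * h) (k : Road) {t x : ℝ}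
    (ht : t ∈ Icc 0 T) (hx : x ∈ Icc (net.link k).a (net.link k).b) :
    |N k t x - N' k t x| ≤ (m + 1) * (Fintype.card Road * β) := by
  have hexit : ∀ s ∈ Icc 0 T, ∀ j,
      |N j s (net.link j).b - N' j s (net.link j).b| ≤ net.exitError β m j := fun s hsm j =>
    hN.abs_exit_sub_le_exitError hN' hs hs' hg hg' hm hm' hh hβ hδ hβl m hsm (hsm.2.trans hmT) j
  have hn : 0 ≤ Fintype.card Road * β := mul_nonneg (Nat.cast_nonneg _) hβ
  have hbd : ∀ p ∈ (net.link k).valueDomain T,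
      |N k p.1 p.2 - N' k p.1 p.2| ≤ (m + 1) * (Fintype.card Road * β) := by
    rintro ⟨s, z⟩ ⟨hsm, hz, h0 | ha | hb⟩ <;> simp only at *
    · rw [h0, hN.initial_eq hN' k hz, sub_self, abs_zero]
      positivity
    · have h1 := hN.abs_entrance_sub_le hN' hs hs' (exitError_nonneg hβ m) hsm (hexit s hsm) k
      -- The entrance error after `m` steps is a part of `exitError β (m + 1) k`, whence the factor
      -- `m + 1`.
      have h2 := exitError_le (net := net) hβ (m + 1) k
      push_cast at h2
      rw [exitError] at h2
      rw [ha]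
      linarith
    · rw [hb]
      linarith [hexit s hsm k, exitError_le (net := net) hβ m k]
  rw [abs_le]
  have h1 := (hN.solvesHJ k).le_add (hN'.solvesHJ k)
    (B := (m + 1) * (Fintype.card Road * β)) (fun p hp => by linarith [(abs_le.1 (hbd p hp)).2]) ht hx
  have h2 := (hN'.solvesHJ k).le_add (hN.solvesHJ k)
    (B := (m + 1) * (Fintype.card Road * β)) (fun p hp => by linarith [(abs_le.1 (hbd p hp)).1]) ht hx
  constructor <;> linarith

end IsSolution

end SignalNetwork

/-! ### Choice of the lag and of the cycle length. -/

theorem corollary4p1 {Road Node : Type*} [Fintype Road] [DecidableEq Node]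
    (net : SignalNetwork Road Node) (T : ℝ) (hT : 0 < T)
    (N₀ : Road → ℝ → ℝ → ℝ) (hN₀ : net.IsSolution T net.continuumControl N₀)
    (hN₀' : net.NoSpillback T N₀) :
    ∀ ε : ℝ, 0 < ε → ∃ δ : ℝ, 0 < δ ∧
      ∀ (Δ : Node → ℝ) (u : Road → ℝ → ℝ) (N : Road → ℝ → ℝ → ℝ),
        (∀ v, 0 < Δ v ∧ Δ v < δ) → net.IsOnOffControl Δ u →
        net.IsSolution T u N → net.NoSpillback T N →
        ∀ k, ∀ t ∈ Set.Icc 0 T, ∀ x ∈ Set.Icc (net.link k).a (net.link k).b,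
          |N k t x - N₀ k t x| < ε := by
  intro ε hε
  set n : ℝ := ((Fintype.card Road : ℕ) : ℝ)
  have hn0 : 0 ≤ n := Nat.cast_nonneg _
  set C : ℝ := ∑ k, (net.link k).capacity 
  have hC0 : 0 ≤ C := Finset.sum_nonneg fun k _ => (net.link k).capacity_nonneg
  have hCk : ∀ k, (net.link k).capacity ≤ C := fun k =>
    Finset.single_le_sum (fun j _ => (net.link j).capacity_nonneg) (Finset.mem_univ k)
  -- The admissible lag error per unit of time. Since `h ≤ 1`, the `m + 1` steps span at most `T +
  -- 2`; `n + 1` avoids division by zero.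
  set ε' : ℝ := ε / (2 * (n + 1) * (T + 2)) with hε'
  have hε'0 : 0 < ε' := by positivity
  obtain ⟨h, hh0, hh1, hlag⟩ : ∃ h : ℝ, 0 < h ∧ h ≤ 1 ∧
      ∀ k, (net.link k).fStar (((net.link k).b - (net.link k).a) / h) ≤ ε' := by
    have h1 : ∀ k, ∀ᶠ h in nhdsWithin (0 : ℝ) (Ioi 0),
        (net.link k).fStar (((net.link k).b - (net.link k).a) / h) ≤ ε' := by
      intro k
      have h2 : Filter.Tendsto (fun h : ℝ => ((net.link k).b - (net.link k).a) / h)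
          (nhdsWithin 0 (Ioi 0)) Filter.atTop := by
        simp only [div_eq_mul_inv]
        exact tendsto_inv_nhdsGT_zero.const_mul_atTop (sub_pos.2 (net.link k).a_lt_b)
      exact ((net.link k).tendsto_fStar_atTop.comp h2).eventually_le_const hε'0
    obtain ⟨h, ha, hb⟩ := ((Filter.eventually_all.2 h1).and (Ioc_mem_nhdsGT one_pos)).exists
    exact ⟨h, hb.1, hb.2, ha⟩
  obtain ⟨m, hm⟩ : ∃ m : ℕ, m = ⌈T / h⌉₊ := ⟨_, rfl⟩
  have hm1 : T ≤ m * h := (div_le_iff₀ hh0).1 (hm ▸ Nat.le_ceil _)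
  have hm2 : (m + 1) * h ≤ T + 2 := by
    have := (Nat.ceil_lt_add_one (div_nonneg hT.le hh0.le)).le
    rw [← hm] at this
    have h3 := mul_le_mul_of_nonneg_right this hh0.le
    rw [add_mul, div_mul_cancel₀ _ hh0.ne'] at h3
    linarith
  -- Chosen after `h`, so that the signal error of one step is at most half the allowance `h * ε'`
  -- for its lag error.
  set δ : ℝ := h * ε' / (2 * (C + 1)) with hδ
  have hδ0 : 0 < δ := by positivity
  refine ⟨δ, hδ0, fun Δ u N hΔ hu hN hN' k t ht x hx => ?_⟩
  have hCδ : C * δ ≤ h * ε' / 2 := by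
    rw [hδ, ← mul_div_assoc, div_le_div_iff₀ (by positivity) two_pos]
    nlinarith [mul_pos hh0 hε'0]
  have hkey := hN.abs_sub_le hN₀ hN' hN₀' hu.mem net.continuumControl_mem hu.measurable
    (fun _ => measurable_const) hh0 (β := h * ε' + h * ε' / 2) (by positivity)
    (fun j s t => hu.abs_integral_sub_split_le hδ0.le hΔ j s t)
    (fun j => add_le_add (mul_le_mul_of_nonneg_left (hlag j) hh0.le)
      ((mul_le_mul_of_nonneg_right (hCk j) hδ0.le).trans hCδ)) hm1 k ht hx
  refine hkey.trans_lt ?_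
  have e1 : ε' * ((n + 1) * (T + 2)) = ε / 2 := by
    rw [hε']; field_simp
  calc (m + 1) * (n * (h * ε' + h * ε' / 2)) = 3 / 2 * (ε' * (n * ((m + 1) * h))) := by ring
    _ ≤ 3 / 2 * (ε' * ((n + 1) * (T + 2))) := by gcongr; linarith
    _ = 3 / 4 * ε := by rw [e1]; ring
    _ < ε := by linarith
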